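/- There exist a finite alphabet $A$ and a finite set $R \subseteq A^* \times A^*$ of defining relations that is homogeneous (that is, $|u| = |v|$ for every $(u,v) \in R$) such that the $o$-conjugacy problem of the monoid $M = \langle A \mid R\rangle$ is undecidable. That is, there is no algorithm that takes as input two words over $A$ and decides whether the elements of $M$ that they represent are $o$-conjugate. Here elements $x, y$ of a monoid $M$ are $o$-conjugate, written $x \sim_o y$, if there exist $g, h \in M$ with $xg = gy$ and $hx = yh$. -/

import Mathlib

/-!
A stack machine that simulates a universal program gives a finite presentation whose word problem
is undecidable: configurations are words, the relations carry out the steps of the machine, and a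
configuration word equals a fixed halting letter if and only if the machine halts from it. One
direction executes the steps; for the other, the letters act on predicates on the stacks in such a
way that a configuration word acts as the predicate that the machine halts.

Every finite presentation `⟨A ∣ R⟩` is made homogeneous by adding a central letter `p` and padding
each relation with it: `u p^|v| = v p^|u|`. A further letter `t`, which satisfies no relation except
to commute with `p`, reduces the word problem of `R` to `o`-conjugacy. If `u = v` in `⟨A ∣ R⟩`, then
`t u p^|v|` and `t v p^|u|` become equal when they are multiplied by a power of `p`, and as `p` is
central, this power conjugates them. Conversely, suppose that `(t u p^|v|) g = g (t v p^|u|)`. Both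
sides are cut by `t` into segments with values in `⟨A ∣ R⟩` (`p` counting as `1`). If those of `g`
are `g₀, …, gₘ`, then `1, u g₀, g₁, …, gₘ` is the same list as `g₀, …, gₘ, v`, so that `g₀ = 1` and
then, term by term, `u = g₁ = ⋯ = gₘ = v`.
-/

/-- `o`-conjugacy in a monoid `M`: `x g = g y` and `h x = y h` for some `g, h` in `M`.
(For a semigroup `S` one takes `g, h` in `S` with an identity adjoined; a monoid already has
an identity, and a second one would act on both equations in the same way.) -/
def OConjugate {M : Type*} [Monoid M] (x y : M) : Prop :=
  ∃ g h : M, x * g = g * y ∧ h * x = y * h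

/-- A set `R` of defining relations over the alphabet `A` is homogeneous if the two sides of
each relation have the same length. -/
def HomogeneousRels {A : Type*} (R : Set (FreeMonoid A × FreeMonoid A)) : Prop :=
  ∀ u v : FreeMonoid A, (u, v) ∈ R → u.length = v.length

/-- The monoid presented by the alphabet `A` and the set `R` of defining relations: the quotient
of the free monoid on `A` by the congruence generated by `R`. -/
abbrev MonoidOfPresentation {A : Type*} (R : Set (FreeMonoid A × FreeMonoid A)) : Type _ :=
  PresentedMonoid (fun u v : FreeMonoid A => (u, v) ∈ R)

/-- The element of the presented monoid that is represented by a word over the alphabet. -/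
def wordClass {A : Type*} (R : Set (FreeMonoid A × FreeMonoid A)) (w : List A) :
    MonoidOfPresentation R :=
  PresentedMonoid.mk (fun u v : FreeMonoid A => (u, v) ∈ R) (FreeMonoid.ofList w)

/-- The `o`-conjugacy problem of a presentation, as a predicate on pairs of words. -/
def OConjugacyProblem {A : Type*} (R : Set (FreeMonoid A × FreeMonoid A))
    (p : List A × List A) : Prop :=
  OConjugate (wordClass R p.1) (wordClass R p.2)

section Presentation

variable {A B : Type*} {R : Set (FreeMonoid A × FreeMonoid A)}

theorem wordClass_surjective : Function.Surjective (wordClass R) :=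
  PresentedMonoid.surjective_mk

theorem wordClass_append (u v : List A) : wordClass R (u ++ v) = wordClass R u * wordClass R v :=
  rfl

theorem wordClass_replicate (k : ℕ) (a : A) :
    wordClass R (List.replicate k a) = wordClass R [a] ^ k := by
  induction k with
  | zero => rfl
  | succ k ih => rw [pow_succ', ← ih, ← wordClass_append]; rfl

theorem wordClass_flatMap {K : Type*} (f : K → List A) (ks : List K) :
    wordClass R (ks.flatMap f) = (ks.map fun k => wordClass R (f k)).prod := by
  induction ks with
  | nil => rfl
  | cons k ks ih => rw [List.flatMap_cons, wordClass_append, ih, List.map_cons, List.prod_cons]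

theorem wordClass_eq_of_mem {u v : List A} (h : (FreeMonoid.ofList u, FreeMonoid.ofList v) ∈ R) :
    wordClass R u = wordClass R v :=
  PresentedMonoid.mk_eq_mk_of_rel (rels := fun u v => (u, v) ∈ R) h

theorem commute_wordClass {x : MonoidOfPresentation R} {u : List A}
    (h : ∀ a ∈ u, Commute x (wordClass R [a])) : Commute x (wordClass R u) := by
  induction u with
  | nil => exact Commute.one_right x
  | cons a u ih =>
    rw [List.forall_mem_cons] at h
    exact h.1.mul_right (ih h.2)

theorem foldr_eq_of_wordClass_eq {X : Type*} {f : A → X → X}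
    (hf : ∀ u v, (u, v) ∈ R → ∀ x, u.toList.foldr f x = v.toList.foldr f x) {u v : List A}
    (h : wordClass R u = wordClass R v) (x : X) : u.foldr f x = v.foldr f x := by
  suffices ∀ u v, conGen (fun u v => (u, v) ∈ R) u v →
      ∀ x, u.toList.foldr f x = v.toList.foldr f x from
    this _ _ (PresentedMonoid.mk_eq_mk_iff.1 h) x
  intro u v h
  induction h with
  | of u v h => exact hf u v h
  | refl => exact fun _ => rfl
  | symm _ ih => exact fun x => (ih x).symm
  | trans _ _ ih₁ ih₂ => exact fun x => (ih₁ x).trans (ih₂ x)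
  | mul _ _ ih₁ ih₂ =>
    intro x
    rw [FreeMonoid.toList_mul, FreeMonoid.toList_mul, List.foldr_append, List.foldr_append,
      ih₁, ih₂]

theorem wordClass_map_eq {S : Set (FreeMonoid B × FreeMonoid B)} {e : A → B}
    (he : ∀ u v, (u, v) ∈ R → (FreeMonoid.map e u, FreeMonoid.map e v) ∈ S) {u v : List A}
    (h : wordClass R u = wordClass R v) : wordClass S (u.map e) = wordClass S (v.map e) := by
  have hle : conGen (fun u v => (u, v) ∈ R) ≤
      Con.comap (FreeMonoid.map e) (map_mul _) (conGen fun u v => (u, v) ∈ S) :=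
    Con.conGen_le.2 fun u v h => .of _ _ (he u v h)
  exact PresentedMonoid.mk_eq_mk_iff.2 (hle (PresentedMonoid.mk_eq_mk_iff.1 h))

/-- The word problem of a presentation, as a predicate on pairs of words. -/
def WordProblem (R : Set (FreeMonoid A × FreeMonoid A)) (p : List A × List A) : Prop :=
  wordClass R p.1 = wordClass R p.2

/-- The set of relations that arises from `R` by renaming the letters along `e`. It serves to pass
from an arbitrary finite alphabet to `Fin n`. -/
def relabelRels (e : A → B) (R : Set (FreeMonoid A × FreeMonoid A)) :
    Set (FreeMonoid B × FreeMonoid B) :=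
  Prod.map (FreeMonoid.map e) (FreeMonoid.map e) '' R

theorem HomogeneousRels.relabelRels (hR : HomogeneousRels R) (e : A → B) :
    HomogeneousRels (relabelRels e R) := by
  rintro _ _ ⟨⟨u, v⟩, h, ⟨⟩⟩
  simpa [FreeMonoid.length] using! hR u v h

theorem wordClass_relabelRels_iff (e : A ≃ B) {u v : List A} :
    wordClass (relabelRels e R) (u.map e) = wordClass (relabelRels e R) (v.map e) ↔
      wordClass R u = wordClass R v := by
  refine ⟨fun h => ?_, wordClass_map_eq fun u v => Set.mem_image_of_mem _⟩
  simpa using wordClass_map_eq (S := R) (e := e.symm) (by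
    rintro _ _ ⟨⟨u, v⟩, h, ⟨⟩⟩
    simpa [FreeMonoid.map_map] using h) h

theorem oConjugate_wordClass_iff {u v : List A} :
    OConjugate (wordClass R u) (wordClass R v) ↔ ∃ g h : List A,
      wordClass R (u ++ g) = wordClass R (g ++ v) ∧ wordClass R (h ++ u) = wordClass R (v ++ h) :=
  wordClass_surjective.exists₂

theorem oConjugate_relabelRels_iff (e : A ≃ B) {u v : List A} :
    OConjugate (wordClass (relabelRels e R) (u.map e)) (wordClass (relabelRels e R) (v.map e)) ↔
      OConjugate (wordClass R u) (wordClass R v) := by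
  rw [oConjugate_wordClass_iff, oConjugate_wordClass_iff,
    (List.map_surjective_iff.2 e.surjective).exists₂]
  simp only [← List.map_append, wordClass_relabelRels_iff]

theorem oConjugacyProblem_reducible_relabelRels [Primcodable A] [Primcodable B] (e : A ≃ B)
    (he : Primrec e) : OConjugacyProblem R ≤₀ OConjugacyProblem (relabelRels e R) := by
  have hmap : Primrec (List.map e) := Primrec.list_map .id (he.comp .snd).to₂
  refine ⟨Prod.map (List.map e) (List.map e),
    (Primrec.pair (hmap.comp .fst) (hmap.comp .snd)).to_comp, fun p => ?_⟩
  exact (oConjugate_relabelRels_iff e).symm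

end Presentation

theorem OConjugate.of_mul_eq_mul {M : Type*} [Monoid M] {x y z : M} (hz : ∀ a, Commute z a)
    (h : x * z = y * z) : OConjugate x y :=
  ⟨z, z, h.trans (hz y).eq.symm, (hz x).eq.trans h⟩

section Padding

/-- The letters of a presentation together with two new ones, `PaddedAlphabet.pad` and
`PaddedAlphabet.separator`. Iterated options make this a `Primcodable` type. -/
abbrev PaddedAlphabet (A : Type*) := Option (Option A)

namespace PaddedAlphabet

variable {A : Type*}

/-- The central letter that makes up for differences in length. -/
abbrev pad : PaddedAlphabet A := none

/-- The letter that keeps the two words of a conjugacy equation apart. -/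
abbrev separator : PaddedAlphabet A := some none

/-- The inclusion of the original letters. -/
abbrev letter (a : A) : PaddedAlphabet A := some (some a)

end PaddedAlphabet

open PaddedAlphabet FreeMonoid

variable {A : Type*} {R : Set (FreeMonoid A × FreeMonoid A)}

/-- The word `u`, padded by the length of `v`: it is as long as `paddedWord v u`. -/
def paddedWord (u v : List A) : List (PaddedAlphabet A) :=
  u.map letter ++ List.replicate v.length pad

/-- The homogeneous presentation attached to `R`: `pad` is central, each relation of `R` is padded
on both sides to the same length, and `separator` satisfies no further relation. -/
def paddedRels (R : Set (FreeMonoid A × FreeMonoid A)) :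
    Set (FreeMonoid (PaddedAlphabet A) × FreeMonoid (PaddedAlphabet A)) :=
  Set.range (fun b => (ofList [pad, b], ofList [b, pad])) ∪
    (fun r => (ofList (paddedWord r.1.toList r.2.toList),
      ofList (paddedWord r.2.toList r.1.toList))) '' R

theorem finite_paddedRels [Finite A] (hR : R.Finite) : (paddedRels R).Finite :=
  (Set.finite_range _).union (hR.image _)

theorem homogeneousRels_paddedRels : HomogeneousRels (paddedRels R) := by
  rintro _ _ (⟨b, ⟨⟩⟩ | ⟨r, -, ⟨⟩⟩)
  · rfl
  · simp [FreeMonoid.length, paddedWord, add_comm]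

theorem commute_pad (x : MonoidOfPresentation (paddedRels R)) :
    Commute (wordClass (paddedRels R) [pad]) x := by
  obtain ⟨w, rfl⟩ := wordClass_surjective x
  exact commute_wordClass fun b _ =>
    wordClass_eq_of_mem (u := [pad, b]) (v := [b, pad]) (.inl ⟨b, rfl⟩)

theorem wordClass_paddedWord (u v : List A) :
    wordClass (paddedRels R) (paddedWord u v) =
      wordClass (paddedRels R) (u.map letter) * wordClass (paddedRels R) [pad] ^ v.length := by
  rw [paddedWord, wordClass_append, wordClass_replicate]

theorem exists_paddedWord_mul_pad_pow_eq {u v : List A} (h : wordClass R u = wordClass R v) :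
    ∃ k, wordClass (paddedRels R) (paddedWord u v) * wordClass (paddedRels R) [pad] ^ k =
      wordClass (paddedRels R) (paddedWord v u) * wordClass (paddedRels R) [pad] ^ k := by
  let p := wordClass (paddedRels R) [pad]
  let ι (w : FreeMonoid A) := wordClass (paddedRels R) (w.toList.map letter)
  suffices ∀ u v, conGen (fun u v => (u, v) ∈ R) u v →
      ∃ k, ι u * p ^ (v.length + k) = ι v * p ^ (u.length + k) by
    obtain ⟨k, hk⟩ := this _ _ (PresentedMonoid.mk_eq_mk_iff.1 h)
    refine ⟨k, ?_⟩
    rw [wordClass_paddedWord, wordClass_paddedWord, mul_assoc, mul_assoc, ← pow_add, ← pow_add]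
    exact hk
  intro u v h
  induction h with
  | of u v h =>
    have := wordClass_eq_of_mem (R := paddedRels R) (.inr ⟨(u, v), h, rfl⟩)
    rw [wordClass_paddedWord, wordClass_paddedWord] at this
    exact ⟨0, this⟩
  | refl u => exact ⟨0, rfl⟩
  | symm _ ih => exact ih.imp fun _ => Eq.symm
  | @trans u v w _ _ ih₁ ih₂ =>
    obtain ⟨k, hk⟩ := ih₁
    obtain ⟨l, hl⟩ := ih₂
    refine ⟨v.length + k + l, ?_⟩
    calc ι u * p ^ (w.length + (v.length + k + l))
        = ι u * p ^ (v.length + k) * p ^ (w.length + l) := by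
          rw [mul_assoc, ← pow_add]; congr 2; ring
      _ = ι v * p ^ (w.length + l) * p ^ (u.length + k) := by
          rw [hk, mul_assoc, mul_assoc, ← pow_add, ← pow_add, add_comm]
      _ = ι w * p ^ (u.length + (v.length + k + l)) := by
          rw [hl, mul_assoc, ← pow_add]; congr 2; ring
  | @mul u v u' v' _ _ ih₁ ih₂ =>
    obtain ⟨k, hk⟩ := ih₁
    obtain ⟨l, hl⟩ := ih₂
    have split_pow (x y : FreeMonoid A) (m n : ℕ) :
        ι (x * y) * p ^ (m + n + (k + l)) = ι x * p ^ (m + k) * (ι y * p ^ (n + l)) := by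
      have hcomm : Commute (ι y) (p ^ (m + k)) := ((commute_pad (ι y)).pow_left _).symm
      have hmul : ι (x * y) = ι x * ι y := by
        simp only [ι, FreeMonoid.toList_mul, List.map_append, wordClass_append]
      rw [← hcomm.mul_mul_mul_comm, ← pow_add, add_add_add_comm, hmul]
    refine ⟨k + l, ?_⟩
    rw [FreeMonoid.length_mul, FreeMonoid.length_mul, split_pow, split_pow, hk, hl]

/-- The action of the padded letters on nonempty lists of elements of the original monoid, given by
head and tail: `separator` starts a new entry, a letter multiplies the head, `pad` does nothing. -/
def segmentAction (R : Set (FreeMonoid A × FreeMonoid A)) :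
    PaddedAlphabet A → MonoidOfPresentation R × List (MonoidOfPresentation R) →
      MonoidOfPresentation R × List (MonoidOfPresentation R)
  | none, x => x
  | some none, (m, l) => (1, m :: l)
  | some (some a), (m, l) => (wordClass R [a] * m, l)

theorem foldr_segmentAction_paddedWord (u v : List A)
    (x : MonoidOfPresentation R × List (MonoidOfPresentation R)) :
    (paddedWord u v).foldr (segmentAction R) x = (wordClass R u * x.1, x.2) := by
  have hpad : (List.replicate v.length pad).foldr (segmentAction R) x = x := by
    induction v with
    | nil => rfl
    | cons _ _ ih => exact ih
  rw [paddedWord, List.foldr_append, hpad]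
  induction u with
  | nil => exact Prod.ext (one_mul _).symm rfl
  | cons a u ih =>
    rw [List.map_cons, List.foldr_cons, ih, segmentAction, ← mul_assoc, ← wordClass_append]
    rfl

theorem foldr_segmentAction_eq_of_wordClass_eq {w z : List (PaddedAlphabet A)}
    (h : wordClass (paddedRels R) w = wordClass (paddedRels R) z)
    (x : MonoidOfPresentation R × List (MonoidOfPresentation R)) :
    w.foldr (segmentAction R) x = z.foldr (segmentAction R) x := by
  refine foldr_eq_of_wordClass_eq ?_ h x
  rintro _ _ (⟨b, ⟨⟩⟩ | ⟨⟨u, v⟩, huv, ⟨⟩⟩) x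
  · rfl
  · simp only [FreeMonoid.toList_ofList, foldr_segmentAction_paddedWord]
    rw [wordClass_eq_of_mem (u := u.toList) (v := v.toList) huv]

theorem foldr_segmentAction_append (w : List (PaddedAlphabet A)) (m : MonoidOfPresentation R)
    (l l' : List (MonoidOfPresentation R)) :
    w.foldr (segmentAction R) (m, l ++ l') =
      ((w.foldr (segmentAction R) (m, l)).1, (w.foldr (segmentAction R) (m, l)).2 ++ l') := by
  induction w with
  | nil => rfl
  | cons b w ih =>
    rw [List.foldr_cons, ih, List.foldr_cons]
    rcases b with _ | _ | a <;> rfl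

theorem eq_of_cons_eq_append_singleton {X : Type*} {a b : X} {l : List X}
    (h : a :: l = l ++ [b]) : a = b := by
  induction l generalizing a with
  | nil => exact List.head_eq_of_cons_eq h
  | cons c l ih => exact (List.cons.inj h).1.trans (ih (List.cons.inj h).2)

/-- The word that represents `u` in the `o`-conjugacy problem to which the comparison of `u` and `v`
is reduced; `v` only determines its length. -/
def comparisonWord (u v : List A) : List (PaddedAlphabet A) :=
  separator :: paddedWord u v

theorem wordClass_eq_of_oConjugate_comparisonWord {u v : List A}
    (h : OConjugate (wordClass (paddedRels R) (comparisonWord u v))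
      (wordClass (paddedRels R) (comparisonWord v u))) : wordClass R u = wordClass R v := by
  obtain ⟨g, -, hg, -⟩ := oConjugate_wordClass_iff.1 h
  set x := g.foldr (segmentAction R) (1, [])
  have hleft : (comparisonWord u v ++ g).foldr (segmentAction R) (1, []) =
      (1, wordClass R u * x.1 :: x.2) := by
    rw [List.foldr_append, comparisonWord, List.foldr_cons, foldr_segmentAction_paddedWord]; rfl
  have hright : (g ++ comparisonWord v u).foldr (segmentAction R) (1, []) =
      (x.1, x.2 ++ [wordClass R v]) := by
    rw [List.foldr_append, comparisonWord, List.foldr_cons, foldr_segmentAction_paddedWord, mul_one]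
    exact foldr_segmentAction_append g 1 [] [wordClass R v]
  obtain ⟨hone, hlist⟩ := Prod.ext_iff.1
    (hleft.symm.trans ((foldr_segmentAction_eq_of_wordClass_eq hg (1, [])).trans hright))
  rw [← hone, mul_one] at hlist
  exact eq_of_cons_eq_append_singleton hlist

theorem oConjugate_comparisonWord_of_wordClass_eq {u v : List A}
    (h : wordClass R u = wordClass R v) :
    OConjugate (wordClass (paddedRels R) (comparisonWord u v))
      (wordClass (paddedRels R) (comparisonWord v u)) := by
  obtain ⟨k, hk⟩ := exists_paddedWord_mul_pad_pow_eq h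
  refine .of_mul_eq_mul (z := wordClass (paddedRels R) [pad] ^ k)
    (fun x => (commute_pad x).pow_left k) ?_
  exact (mul_assoc _ _ _).trans
    ((congrArg (wordClass (paddedRels R) [separator] * ·) hk).trans (mul_assoc _ _ _).symm)

theorem primrec_comparisonWord [Primcodable A] :
    Primrec₂ (comparisonWord : List A → List A → List (PaddedAlphabet A)) := by
  have hletter : Primrec (letter : A → PaddedAlphabet A) := Primrec.option_some.comp .option_some
  have hpads : Primrec fun v : List A => List.replicate v.length (pad : PaddedAlphabet A) :=
    (Primrec.list_map .id (Primrec.const pad).to₂).of_eq fun v => List.map_const'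
  exact Primrec.list_cons.comp (.const _) (Primrec.list_append.comp
    (Primrec.list_map .fst (hletter.comp .snd).to₂) (hpads.comp .snd))

theorem wordProblem_reducible_oConjugacyProblem_paddedRels [Primcodable A] :
    WordProblem R ≤₀ OConjugacyProblem (paddedRels R) :=
  ⟨fun p => (comparisonWord p.1 p.2, comparisonWord p.2 p.1),
    (Primrec.pair primrec_comparisonWord
      (primrec_comparisonWord.comp Primrec.snd Primrec.fst)).to_comp,
    fun _ => ⟨oConjugate_comparisonWord_of_wordClass_eq,
      wordClass_eq_of_oConjugate_comparisonWord⟩⟩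

end Padding

section StackMachine

open Turing
open Function (update)

variable {K : Type*} {Γ : K → Type*} {Λ σ : Type*}

/-- The letters of the presentation attached to a stack machine whose statements range over `T`:
`stack k none` is the bottom of the stack `k`, `stack k (some a)` is an entry of it, `state q v`
means that the statement `q` is about to be run with the local variables `v`. -/
inductive StackLetter (T : Set (TM2.Stmt Γ Λ σ)) : Type _
  | stack (k : K) (o : Option (Γ k)) : StackLetter T
  | state (q : T) (v : σ) : StackLetter T
  | halted : StackLetter T

open StackLetter

instance {T : Set (TM2.Stmt Γ Λ σ)} [Finite T] [Finite σ] [Finite K] [∀ k, Finite (Γ k)] :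
    Finite (StackLetter T) := by
  let f : ((Σ k, Option (Γ k)) ⊕ (T × σ)) ⊕ Unit → StackLetter T :=
    Sum.elim (Sum.elim (fun p => stack p.1 p.2) (fun p => state p.1 p.2)) (fun _ => halted)
  refine Finite.of_surjective f ?_
  rintro (⟨k, o⟩ | ⟨q, v⟩ | _)
  exacts [⟨.inl (.inl ⟨k, o⟩), rfl⟩, ⟨.inl (.inr (q, v)), rfl⟩, ⟨.inr (), rfl⟩]

open TM2.Stmt in
/-- The relations of the presentation attached to the stack machine `M`. They let the letters of
different stacks commute, so that every stack can be moved next to the state letter, where the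
current statement is run. Once the machine has halted, its stacks are erased. -/
inductive StackRel (M : Λ → TM2.Stmt Γ Λ σ) (T : Set (TM2.Stmt Γ Λ σ)) :
    List (StackLetter T) → List (StackLetter T) → Prop
  | comm {k l} (h : k ≠ l) (o p) :
      StackRel M T [stack k o, stack l p] [stack l p, stack k o]
  | push {k f q} (h h' v) :
      StackRel M T [state ⟨push k f q, h⟩ v] [stack k (some (f v)), state ⟨q, h'⟩ v]
  | peek {k f q} (h h' v o) :
      StackRel M T [stack k o, state ⟨peek k f q, h⟩ v] [stack k o, state ⟨q, h'⟩ (f v o)]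
  | pop {k f q} (h h' v a) :
      StackRel M T [stack k (some a), state ⟨pop k f q, h⟩ v] [state ⟨q, h'⟩ (f v (some a))]
  | pop_bottom {k f q} (h h' v) :
      StackRel M T [stack k none, state ⟨pop k f q, h⟩ v] [stack k none, state ⟨q, h'⟩ (f v none)]
  | load {f q} (h h' v) : StackRel M T [state ⟨load f q, h⟩ v] [state ⟨q, h'⟩ (f v)]
  | branch_true {f q₁ q₂} (h h' v) (hf : f v = true) :
      StackRel M T [state ⟨branch f q₁ q₂, h⟩ v] [state ⟨q₁, h'⟩ v]
  | branch_false {f q₁ q₂} (h h' v) (hf : f v = false) :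
      StackRel M T [state ⟨branch f q₁ q₂, h⟩ v] [state ⟨q₂, h'⟩ v]
  | goto {f} (h v h') : StackRel M T [state ⟨goto f, h⟩ v] [state ⟨M (f v), h'⟩ v]
  | halt (h v) : StackRel M T [state ⟨halt, h⟩ v] [halted]
  | absorb (k o) : StackRel M T [stack k o, halted] [halted]

/-- The relations `StackRel`, as a set of pairs in the free monoid. -/
def stackRels (M : Λ → TM2.Stmt Γ Λ σ) (T : Set (TM2.Stmt Γ Λ σ)) :
    Set (FreeMonoid (StackLetter T) × FreeMonoid (StackLetter T)) :=
  {p | StackRel M T p.1.toList p.2.toList}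

theorem finite_stackRels (M : Λ → TM2.Stmt Γ Λ σ) (T : Set (TM2.Stmt Γ Λ σ)) [Finite T] [Finite σ]
    [Finite K] [∀ k, Finite (Γ k)] : (stackRels M T).Finite := by
  have hshort := List.finite_length_le (StackLetter T) 2
  refine (hshort.prod hshort).subset ?_
  rintro ⟨u, v⟩ (h : StackRel M T u v)
  cases h <;> constructor <;> simp

theorem wordClass_eq_of_stackRel {M : Λ → TM2.Stmt Γ Λ σ} {T : Set (TM2.Stmt Γ Λ σ)}
    {u v : List (StackLetter T)} (h : StackRel M T u v) :
    wordClass (stackRels M T) u = wordClass (stackRels M T) v :=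
  wordClass_eq_of_mem h

/-- The letters of a stack, from the bottom to the top. -/
def stackWord (T : Set (TM2.Stmt Γ Λ σ)) (k : K) (l : List (Γ k)) : List (StackLetter T) :=
  stack k none :: l.reverse.map fun a => stack k (some a)

theorem stackWord_cons (T : Set (TM2.Stmt Γ Λ σ)) (k : K) (a : Γ k) (l : List (Γ k)) :
    stackWord T k (a :: l) = stackWord T k l ++ [stack k (some a)] := by
  simp only [stackWord, List.reverse_cons, List.map_append, List.map_cons, List.map_nil,
    List.cons_append]

theorem exists_stackWord_eq_append_head? (T : Set (TM2.Stmt Γ Λ σ)) (k : K) (l : List (Γ k)) :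
    ∃ w, stackWord T k l = w ++ [stack k l.head?] := by
  cases l with
  | nil => exact ⟨[], rfl⟩
  | cons a l => exact ⟨_, stackWord_cons T k a l⟩

theorem exists_eq_stack_of_mem_stackWord {T : Set (TM2.Stmt Γ Λ σ)} {k : K} {l : List (Γ k)}
    {x : StackLetter T} (hx : x ∈ stackWord T k l) : ∃ o, stack k o = x := by
  rcases List.mem_cons.1 hx with rfl | hx
  · exact ⟨none, rfl⟩
  · exact (List.exists_of_mem_map hx).imp' some fun _ h => h.2

/-- The contents `S` of the stacks in the list `ks`, one after the other. -/
def stacksWord (T : Set (TM2.Stmt Γ Λ σ)) (ks : List K) (S : ∀ k, List (Γ k)) :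
    List (StackLetter T) :=
  ks.flatMap fun k => stackWord T k (S k)

/-- The word for the configuration with stacks `S` that is about to run the statement `q`. -/
def configWord {T : Set (TM2.Stmt Γ Λ σ)} (ks : List K) (q : T) (v : σ) (S : ∀ k, List (Γ k)) :
    List (StackLetter T) :=
  stacksWord T ks S ++ [state q v]

/-- The machine `M` halts when it runs the statement `q` with local variables `v` and stacks `S`. -/
def HaltsFrom [DecidableEq K] (M : Λ → TM2.Stmt Γ Λ σ) (q : TM2.Stmt Γ Λ σ) (v : σ)
    (S : ∀ k, List (Γ k)) : Prop :=
  (StateTransition.eval (TM2.step M) (TM2.stepAux q v S)).Dom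

theorem haltsFrom_goto [DecidableEq K] (M : Λ → TM2.Stmt Γ Λ σ) (f : σ → Λ) (v : σ)
    (S : ∀ k, List (Γ k)) : HaltsFrom M (.goto f) v S ↔ HaltsFrom M (M (f v)) v S := by
  unfold HaltsFrom
  rw [StateTransition.reaches_eval (f := TM2.step M) (a := TM2.stepAux (.goto f) v S)
    (Relation.ReflTransGen.single (b := TM2.stepAux (M (f v)) v S) rfl)]

theorem haltsFrom_halt [DecidableEq K] (M : Λ → TM2.Stmt Γ Λ σ) (v : σ) (S : ∀ k, List (Γ k)) :
    HaltsFrom M .halt v S :=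
  Part.dom_iff_mem.2 ⟨_, StateTransition.mem_eval.2 ⟨.refl, rfl⟩⟩

section Soundness

variable [DecidableEq K] {M : Λ → TM2.Stmt Γ Λ σ} {T : Set (TM2.Stmt Γ Λ σ)}

/-- The action of the letters on predicates on the stacks, which reads a word from left to right as
a program: stack letters clear a stack or push onto it, and a state letter asks whether the machine
halts. -/
def stackAction (M : Λ → TM2.Stmt Γ Λ σ) (T : Set (TM2.Stmt Γ Λ σ)) :
    StackLetter T → ((∀ k, List (Γ k)) → Prop) → (∀ k, List (Γ k)) → Prop
  | stack k none => fun P S => P (update S k [])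
  | stack k (some a) => fun P S => P (update S k (a :: S k))
  | state q v => fun _ S => HaltsFrom M q v S
  | halted => fun _ _ => True

theorem StackRel.foldr_stackAction_eq {u v : List (StackLetter T)} (h : StackRel M T u v)
    (P : (∀ k, List (Γ k)) → Prop) :
    u.foldr (stackAction M T) P = v.foldr (stackAction M T) P := by
  funext S
  cases h <;> simp only [List.foldr_cons, List.foldr_nil]
  case comm k l h o p =>
    cases o <;> cases p <;>
      simp [stackAction, Function.update_of_ne h, Function.update_of_ne h.symm,
        Function.update_comm h]
  case peek k f q h h' v o => cases o <;> simp [stackAction, HaltsFrom]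
  case goto f h v h' => exact propext (haltsFrom_goto M f v S)
  case halt h v => exact propext (iff_true_intro (haltsFrom_halt M v S))
  case absorb k o => cases o <;> rfl
  all_goals simp [stackAction, HaltsFrom, *]

theorem foldr_stackAction_stackWord (k : K) (l : List (Γ k)) (P : (∀ k, List (Γ k)) → Prop)
    (S : ∀ k, List (Γ k)) :
    (stackWord T k l).foldr (stackAction M T) P S = P (update S k l) := by
  induction l generalizing P with
  | nil => rfl
  | cons a l ih =>
    rw [stackWord_cons, List.foldr_append, ih]
    simp only [List.foldr_cons, List.foldr_nil, stackAction, Function.update_self,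
      Function.update_idem]

theorem foldr_stackAction_stacksWord (ks : List K) (S S₀ : ∀ k, List (Γ k))
    (P : (∀ k, List (Γ k)) → Prop) :
    (stacksWord T ks S).foldr (stackAction M T) P S₀ = P fun k => if k ∈ ks then S k else S₀ k := by
  induction ks generalizing S₀ with
  | nil => simp [stacksWord]
  | cons k ks ih =>
    rw [stacksWord, List.flatMap_cons, List.foldr_append, foldr_stackAction_stackWord]
    refine (ih _).trans (congrArg P (funext fun j => ?_))
    rcases eq_or_ne j k with rfl | h
    · simp
    · simp [h]

theorem haltsFrom_of_wordClass_eq_halted {ks : List K} (hks : ∀ k, k ∈ ks) {q : T} {v : σ}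
    {S : ∀ k, List (Γ k)}
    (h : wordClass (stackRels M T) (configWord ks q v S) = wordClass (stackRels M T) [halted]) :
    HaltsFrom M q v S := by
  have haction := congrFun (foldr_eq_of_wordClass_eq (f := stackAction M T)
    (fun _ _ h => StackRel.foldr_stackAction_eq h) h fun _ => True) S
  simpa only [configWord, List.foldr_append, foldr_stackAction_stacksWord, hks, if_true,
    List.foldr_cons, List.foldr_nil, stackAction, eq_iff_iff, iff_true] using haction

end Soundness

section Completeness

variable {M : Λ → TM2.Stmt Γ Λ σ} {T : Set (TM2.Stmt Γ Λ σ)} {ks : List K}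

theorem commute_wordClass_stackWord {j k : K} (hjk : j ≠ k) (l : List (Γ j)) (l' : List (Γ k)) :
    Commute (wordClass (stackRels M T) (stackWord T j l))
      (wordClass (stackRels M T) (stackWord T k l')) := by
  refine commute_wordClass fun x hx => (commute_wordClass fun y hy => ?_).symm
  obtain ⟨o, rfl⟩ := exists_eq_stack_of_mem_stackWord hx
  obtain ⟨p, rfl⟩ := exists_eq_stack_of_mem_stackWord hy
  exact wordClass_eq_of_stackRel (.comm hjk.symm o p)

theorem wordClass_stacksWord_perm {ks ks' : List K} (h : ks.Perm ks') (hks : ks.Nodup)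
    (S : ∀ k, List (Γ k)) :
    wordClass (stackRels M T) (stacksWord T ks S) =
      wordClass (stackRels M T) (stacksWord T ks' S) := by
  rw [stacksWord, stacksWord, wordClass_flatMap, wordClass_flatMap]
  exact (h.map _).prod_eq'
    (List.pairwise_map.2 (hks.imp fun hjk => commute_wordClass_stackWord hjk _ _))

theorem wordClass_stacksWord_update [DecidableEq K] (hks : ks.Nodup) {k : K} (hk : k ∈ ks)
    (S : ∀ k, List (Γ k)) (l : List (Γ k)) :
    wordClass (stackRels M T) (stacksWord T ks (update S k l)) =
      wordClass (stackRels M T) (stacksWord T (ks.erase k) S ++ stackWord T k l) := by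
  have hperm : ks.Perm (ks.erase k ++ [k]) :=
    (List.perm_cons_erase hk).trans (List.perm_append_singleton k _).symm
  have hrest : stacksWord T (ks.erase k) (update S k l) = stacksWord T (ks.erase k) S :=
    List.flatMap_congr fun j hj => by
      rw [Function.update_of_ne ((hks.mem_erase_iff).1 hj).1]
  rw [wordClass_stacksWord_perm hperm hks, ← hrest]
  simp only [stacksWord, List.flatMap_append, List.flatMap_cons, List.flatMap_nil,
    List.append_nil, Function.update_self]

theorem wordClass_configWord_eq_of_state {q q' : T} {v v' : σ} (S : ∀ k, List (Γ k))
    (h : StackRel M T [state q v] [state q' v']) :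
    wordClass (stackRels M T) (configWord ks q v S) =
      wordClass (stackRels M T) (configWord ks q' v' S) :=
  congrArg (wordClass _ (stacksWord T ks S) * ·) (wordClass_eq_of_stackRel h)

theorem wordClass_configWord_eq_of_stackWord [DecidableEq K] (hks : ks.Nodup) {k : K} (hk : k ∈ ks)
    {q q' : T} {v v' : σ} (S : ∀ k, List (Γ k)) (l : List (Γ k))
    (h : wordClass (stackRels M T) (stackWord T k (S k) ++ [state q v]) =
      wordClass (stackRels M T) (stackWord T k l ++ [state q' v'])) :
    wordClass (stackRels M T) (configWord ks q v S) =
      wordClass (stackRels M T) (configWord ks q' v' (update S k l)) := by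
  have hsplit (q : T) (v : σ) (l : List (Γ k)) :
      wordClass (stackRels M T) (configWord ks q v (update S k l)) =
        wordClass (stackRels M T) (stacksWord T (ks.erase k) S) *
          wordClass (stackRels M T) (stackWord T k l ++ [state q v]) := by
    rw [configWord, wordClass_append, wordClass_stacksWord_update hks hk, wordClass_append,
      wordClass_append, mul_assoc]
  rw [hsplit, ← h, ← hsplit, Function.update_eq_self]

theorem wordClass_configWord_push [DecidableEq K] (hks : ks.Nodup) {k : K} (hk : k ∈ ks)
    {f : σ → Γ k} {q : TM2.Stmt Γ Λ σ} (h : .push k f q ∈ T) (h' : q ∈ T) (v : σ)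
    (S : ∀ k, List (Γ k)) :
    wordClass (stackRels M T) (configWord ks ⟨.push k f q, h⟩ v S) =
      wordClass (stackRels M T) (configWord ks ⟨q, h'⟩ v (update S k (f v :: S k))) := by
  refine wordClass_configWord_eq_of_stackWord hks hk S _ ?_
  rw [stackWord_cons, List.append_assoc]
  exact congrArg (wordClass _ (stackWord T k (S k)) * ·) (wordClass_eq_of_stackRel (.push h h' v))

theorem wordClass_configWord_peek (hks : ks.Nodup) {k : K} (hk : k ∈ ks)
    {f : σ → Option (Γ k) → σ} {q : TM2.Stmt Γ Λ σ} (h : .peek k f q ∈ T) (h' : q ∈ T) (v : σ)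
    (S : ∀ k, List (Γ k)) :
    wordClass (stackRels M T) (configWord ks ⟨.peek k f q, h⟩ v S) =
      wordClass (stackRels M T) (configWord ks ⟨q, h'⟩ (f v (S k).head?) S) := by
  classical
  conv_rhs => rw [← Function.update_eq_self k S]
  refine wordClass_configWord_eq_of_stackWord hks hk S _ ?_
  obtain ⟨w, hw⟩ := exists_stackWord_eq_append_head? T k (S k)
  rw [Function.update_eq_self, hw, List.append_assoc, List.append_assoc]
  exact congrArg (wordClass _ w * ·) (wordClass_eq_of_stackRel (.peek h h' v _))

theorem wordClass_configWord_pop [DecidableEq K] (hks : ks.Nodup) {k : K} (hk : k ∈ ks)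
    {f : σ → Option (Γ k) → σ} {q : TM2.Stmt Γ Λ σ} (h : .pop k f q ∈ T) (h' : q ∈ T) (v : σ)
    (S : ∀ k, List (Γ k)) :
    wordClass (stackRels M T) (configWord ks ⟨.pop k f q, h⟩ v S) =
      wordClass (stackRels M T)
        (configWord ks ⟨q, h'⟩ (f v (S k).head?) (update S k (S k).tail)) := by
  refine wordClass_configWord_eq_of_stackWord hks hk S _ ?_
  cases S k with
  | nil => exact wordClass_eq_of_stackRel (.pop_bottom h h' v)
  | cons a l =>
    rw [stackWord_cons, List.append_assoc]
    exact congrArg (wordClass _ (stackWord T k l) * ·) (wordClass_eq_of_stackRel (.pop h h' v a))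

theorem wordClass_stackWord_append_halted (k : K) (l : List (Γ k)) :
    wordClass (stackRels M T) (stackWord T k l ++ [halted]) =
      wordClass (stackRels M T) [halted] := by
  induction l with
  | nil => exact wordClass_eq_of_stackRel (.absorb k none)
  | cons a l ih =>
    rw [stackWord_cons, List.append_assoc, wordClass_append]
    exact (congrArg _ (wordClass_eq_of_stackRel (.absorb k (some a)))).trans ih

theorem wordClass_stacksWord_append_halted (ks : List K) (S : ∀ k, List (Γ k)) :
    wordClass (stackRels M T) (stacksWord T ks S ++ [halted]) =
      wordClass (stackRels M T) [halted] := by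
  induction ks with
  | nil => rfl
  | cons k ks ih =>
    rw [stacksWord, List.flatMap_cons, List.append_assoc, wordClass_append]
    exact (congrArg _ ih).trans (wordClass_stackWord_append_halted k (S k))

theorem wordClass_configWord_halt (h : .halt ∈ T) (v : σ) (S : ∀ k, List (Γ k)) :
    wordClass (stackRels M T) (configWord ks ⟨.halt, h⟩ v S) =
      wordClass (stackRels M T) [halted] :=
  (congrArg (wordClass _ (stacksWord T ks S) * ·) (wordClass_eq_of_stackRel (.halt h v))).trans
    (wordClass_stacksWord_append_halted ks S)

/-- A set of statements that contains every statement the machine `M` may come to run after one of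
them. -/
structure IsStepClosed (M : Λ → TM2.Stmt Γ Λ σ) (T : Set (TM2.Stmt Γ Λ σ)) : Prop where
  stmts₁_subset {q : TM2.Stmt Γ Λ σ} (hq : q ∈ T) : (TM2.stmts₁ q : Set (TM2.Stmt Γ Λ σ)) ⊆ T
  goto_mem {f : σ → Λ} (hf : .goto f ∈ T) (v : σ) : M (f v) ∈ T

/-- The configurations whose words represent the same element as `halted`. A configuration that has
halted is not written as a word, and counts among them. -/
def IsHaltedConfig (M : Λ → TM2.Stmt Γ Λ σ) (T : Set (TM2.Stmt Γ Λ σ)) (ks : List K) :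
    TM2.Cfg Γ Λ σ → Prop
  | ⟨none, _, _⟩ => True
  | ⟨some l, v, S⟩ => ∀ h : M l ∈ T,
    wordClass (stackRels M T) (configWord ks ⟨M l, h⟩ v S) = wordClass (stackRels M T) [halted]

theorem wordClass_eq_halted_of_isHaltedConfig_stepAux [DecidableEq K] (hT : IsStepClosed M T)
    (hks : ks.Nodup) (hks' : ∀ k, k ∈ ks) {q : TM2.Stmt Γ Λ σ} (hq : q ∈ T) {v : σ}
    {S : ∀ k, List (Γ k)} (h : IsHaltedConfig M T ks (TM2.stepAux q v S)) :
    wordClass (stackRels M T) (configWord ks ⟨q, hq⟩ v S) =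
      wordClass (stackRels M T) [halted] := by
  have hsub := hT.stmts₁_subset hq
  induction q generalizing v S with
    simp only [TM2.stmts₁, Finset.coe_insert, Finset.coe_union, Set.insert_subset_iff,
      Set.union_subset_iff] at hsub
  | push k f q ih =>
    have hq' := hsub.2 TM2.stmts₁_self
    exact (wordClass_configWord_push hks (hks' k) hq hq' v S).trans (ih hq' h hsub.2)
  | peek k f q ih =>
    have hq' := hsub.2 TM2.stmts₁_self
    exact (wordClass_configWord_peek hks (hks' k) hq hq' v S).trans (ih hq' h hsub.2)
  | pop k f q ih =>
    have hq' := hsub.2 TM2.stmts₁_self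
    exact (wordClass_configWord_pop hks (hks' k) hq hq' v S).trans (ih hq' h hsub.2)
  | load f q ih =>
    have hq' := hsub.2 TM2.stmts₁_self
    exact (wordClass_configWord_eq_of_state S (.load hq hq' v)).trans (ih hq' h hsub.2)
  | branch f q₁ q₂ ih₁ ih₂ =>
    have hq₁ := hsub.2.1 TM2.stmts₁_self
    have hq₂ := hsub.2.2 TM2.stmts₁_self
    rw [TM2.stepAux] at h
    cases hf : f v <;> rw [hf] at h
    · exact (wordClass_configWord_eq_of_state S (.branch_false hq hq₂ v hf)).trans
        (ih₂ hq₂ h hsub.2.2)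
    · exact (wordClass_configWord_eq_of_state S (.branch_true hq hq₁ v hf)).trans
        (ih₁ hq₁ h hsub.2.1)
  | goto f => exact (wordClass_configWord_eq_of_state S (.goto hq v _)).trans (h (hT.goto_mem hq v))
  | halt => exact wordClass_configWord_halt hq v S

theorem wordClass_eq_halted_of_haltsFrom [DecidableEq K] (hT : IsStepClosed M T) (hks : ks.Nodup)
    (hks' : ∀ k, k ∈ ks) {q : T} {v : σ} {S : ∀ k, List (Γ k)} (h : HaltsFrom M q v S) :
    wordClass (stackRels M T) (configWord ks q v S) = wordClass (stackRels M T) [halted] := by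
  obtain ⟨c, hc⟩ := Part.dom_iff_mem.1 h
  refine wordClass_eq_halted_of_isHaltedConfig_stepAux hT hks hks' q.2 ?_
  refine StateTransition.evalInduction (C := IsHaltedConfig M T ks) hc fun d _ ih => ?_
  match d with
  | ⟨none, _, _⟩ => trivial
  | ⟨some l, v, S⟩ =>
    exact fun hl => wordClass_eq_halted_of_isHaltedConfig_stepAux hT hks hks' hl (ih _ rfl)

theorem wordClass_configWord_eq_halted_iff [DecidableEq K] (hT : IsStepClosed M T)
    (hks : ks.Nodup) (hks' : ∀ k, k ∈ ks) {q : T} {v : σ} {S : ∀ k, List (Γ k)} :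
    wordClass (stackRels M T) (configWord ks q v S) = wordClass (stackRels M T) [halted] ↔
      HaltsFrom M q v S :=
  ⟨haltsFrom_of_wordClass_eq_halted hks', wordClass_eq_halted_of_haltsFrom hT hks hks'⟩

end Completeness

/-- The statements that occur in the program of the machine `M` at a label in `L`. -/
def stmtsOf (M : Λ → TM2.Stmt Γ Λ σ) (L : Finset Λ) : Set (TM2.Stmt Γ Λ σ) :=
  ⋃ l ∈ L, TM2.stmts₁ (M l)

theorem mem_stmtsOf {M : Λ → TM2.Stmt Γ Λ σ} {L : Finset Λ} {l : Λ} (hl : l ∈ L) :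
    M l ∈ stmtsOf M L :=
  Set.mem_biUnion hl TM2.stmts₁_self

theorem finite_stmtsOf (M : Λ → TM2.Stmt Γ Λ σ) (L : Finset Λ) : (stmtsOf M L).Finite :=
  L.finite_toSet.biUnion fun l _ => (TM2.stmts₁ (M l)).finite_toSet

theorem isStepClosed_stmtsOf {M : Λ → TM2.Stmt Γ Λ σ} {L : Finset Λ}
    (hL : ∀ l ∈ L, TM2.SupportsStmt L (M l)) : IsStepClosed M (stmtsOf M L) where
  stmts₁_subset hq := by
    obtain ⟨l, hl, hq⟩ := Set.mem_iUnion₂.1 hq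
    exact fun r hr => Set.mem_biUnion hl (TM2.stmts₁_trans hq hr)
  goto_mem hf v := by
    obtain ⟨l, hl, hf⟩ := Set.mem_iUnion₂.1 hf
    exact mem_stmtsOf (TM2.stmts₁_supportsStmt_mono hf (hL l hl) v)

end StackMachine

section Reduction

open Turing Turing.PartrecToTM2

theorem nat_bits_of_ne_zero {n : ℕ} (hn : n ≠ 0) : n.bits = n.bodd :: n.div2.bits := by
  conv_lhs => rw [← Nat.bit_bodd_div2 n]
  refine Nat.bits_append_bit _ _ fun h => ?_
  have := Nat.bit_bodd_div2 n
  cases hb : n.bodd <;> simp_all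

theorem primrec_nat_bits : Primrec Nat.bits := by
  suffices Primrec₂ fun (_ : Unit) n => Nat.bits n from this.comp (.const ()) .id
  refine Primrec.nat_strong_rec _ (g := fun _ L => if L.length = 0 then some [] else
    L[L.length.div2]?.map (L.length.bodd :: ·)) ?_ fun _ n => ?_
  · have hlen : Primrec fun p : Unit × List (List Bool) => p.2.length :=
      Primrec.list_length.comp .snd
    exact Primrec.ite (Primrec.eq.comp hlen (.const 0)) (.const _)
      (Primrec.option_map (Primrec.list_getElem?.comp .snd (Primrec.nat_div2.comp hlen))
        (Primrec.list_cons.comp (Primrec.nat_bodd.comp (hlen.comp .fst)) .snd))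
  · rcases eq_or_ne n 0 with rfl | hn
    · simp
    · have hlt : n.div2 < n := by
        rw [Nat.div2_val]
        exact Nat.div_lt_self (Nat.pos_of_ne_zero hn) one_lt_two
      simp [hn, hlt, nat_bits_of_ne_zero hn]

theorem trNat_eq_map_bits (n : ℕ) : trNat n = n.bits.map (cond · Γ'.bit1 Γ'.bit0) := by
  have htrPosNum (p : PosNum) : trPosNum p = (p : ℕ).bits.map (cond · Γ'.bit1 Γ'.bit0) := by
    induction p with
    | one => rfl
    | bit0 p ih =>
      rw [trPosNum, ih, PosNum.cast_bit0, ← two_mul, Nat.bit0_bits _ (PosNum.to_nat_pos p).ne']; rfl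
    | bit1 p ih => rw [trPosNum, ih, PosNum.cast_bit1, ← two_mul, Nat.bit1_bits]; rfl
  rw [trNat]
  conv_rhs => rw [← Num.to_of_nat n]
  cases (n : Num) with
  | zero => rfl
  | pos p => exact htrPosNum p

theorem exists_universal_halting_code : ∃ c : ToPartrec.Code, ∀ p : Nat.Partrec.Code,
    (c.eval [Encodable.encode p]).Dom ↔ (p.eval 0).Dom := by
  have hf : Partrec fun n : ℕ => (Denumerable.ofNat Nat.Partrec.Code n).eval 0 :=
    Nat.Partrec.Code.eval_part.comp (Computable.ofNat _) (Computable.const 0)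
  obtain ⟨c, hc⟩ := ToPartrec.Code.exists_code (Nat.Partrec'.part_iff₁.2 hf)
  refine ⟨c, fun p => ?_⟩
  have := hc ⟨[Encodable.encode p], rfl⟩
  rw [this]
  simp [List.Vector.head]

/-- The list of all stacks of the machines that run the programs in `Turing.ToPartrec.Code`. -/
def stackList : List K' := [K'.main, K'.rev, K'.aux, K'.stack]

theorem mem_stackList (k : K') : k ∈ stackList := by
  cases k <;> decide

instance : Finite K' :=
  Set.finite_univ_iff.1 ((List.finite_toSet stackList).subset fun k _ => mem_stackList k)

variable (c : ToPartrec.Code)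

/-- The statements that the stack machine of the program `c` runs. -/
def programStmts : Set (TM2.Stmt (fun _ : K' => Γ') Λ' (Option Γ')) :=
  stmtsOf tr (codeSupp c Cont'.halt)

instance : Finite (programStmts c) :=
  finite_stmtsOf tr (codeSupp c Cont'.halt)

/-- The first statement that the stack machine of the program `c` runs. -/
def initialStmt : programStmts c :=
  ⟨tr (trNormal c Cont'.halt), mem_stmtsOf (tr_supports c Cont'.halt).1⟩

/-- The word for the initial configuration of the program `c` on the input `n`. -/
def initialWord (n : ℕ) : List (StackLetter (programStmts c)) :=
  configWord stackList (initialStmt c) none (K'.elim (trList [n]) [] [] [])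

theorem wordClass_initialWord_eq_halted_iff {n : ℕ} :
    wordClass (stackRels tr (programStmts c)) (initialWord c n) =
      wordClass (stackRels tr (programStmts c)) [.halted] ↔ (c.eval [n]).Dom := by
  have hclosed : IsStepClosed tr (programStmts c) :=
    isStepClosed_stmtsOf (tr_supports c Cont'.halt).2
  calc
    _ ↔ HaltsFrom tr (initialStmt c) none (K'.elim (trList [n]) [] [] []) :=
      wordClass_configWord_eq_halted_iff hclosed (by decide) mem_stackList
    _ ↔ HaltsFrom tr (.goto fun _ => trNormal c Cont'.halt) none (K'.elim (trList [n]) [] [] []) :=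
      (haltsFrom_goto tr (fun _ => trNormal c Cont'.halt) none _).symm
    _ ↔ (c.eval [n]).Dom := .of_eq (congrArg Part.Dom (tr_eval c [n]))

theorem primrec_map_initialWord {α : Type*} [Primcodable α]
    (g : StackLetter (programStmts c) → α) : Primrec fun n => (initialWord c n).map g := by
  let bit (b : Bool) : α := g (.stack K'.main (some (cond b Γ'.bit1 Γ'.bit0)))
  have hword (n : ℕ) : (initialWord c n).map g =
      [g (.stack K'.main none), g (.stack K'.main (some Γ'.cons))] ++ ((n.bits.map bit).reverse ++
        [g (.stack K'.rev none), g (.stack K'.aux none), g (.stack K'.stack none),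
          g (.state (initialStmt c) none)]) := by
    simp [initialWord, configWord, stacksWord, stackList, stackWord, trList, trNat_eq_map_bits,
      bit, Function.comp_def]
  refine Primrec.of_eq ?_ fun n => (hword n).symm
  exact Primrec.list_append.comp (.const _) <| Primrec.list_append.comp
    (Primrec.list_reverse.comp
      (Primrec.list_map primrec_nat_bits ((Primrec.dom_finite bit).comp .snd).to₂)) (.const _)

theorem exists_finite_not_computablePred_wordProblem :
    ∃ (n : ℕ) (R : Set (FreeMonoid (Fin n) × FreeMonoid (Fin n))),
      R.Finite ∧ ¬ ComputablePred (WordProblem R) := by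
  obtain ⟨c, hc⟩ := exists_universal_halting_code
  obtain ⟨n, ⟨e⟩⟩ := Finite.exists_equiv_fin (StackLetter (programStmts c))
  refine ⟨n, relabelRels e (stackRels tr (programStmts c)), (finite_stackRels _ _).image _,
    fun h => ComputablePred.halting_problem 0 (.computable_of_manyOneReducible ?_ h)⟩
  refine ⟨fun p => ((initialWord c (Encodable.encode p)).map e, [e .halted]),
    (Primrec.pair ((primrec_map_initialWord c e).comp .encode) (.const _)).to_comp, fun p => ?_⟩
  exact (hc p).symm.trans
    ((wordClass_initialWord_eq_halted_iff c).symm.trans (wordClass_relabelRels_iff e).symm)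

end Reduction

/-- There is a finite alphabet `Fin n` and a finite homogeneous set `R` of defining relations over
it such that no algorithm decides, given two words over the alphabet, whether the elements of the
presented monoid that they represent are `o`-conjugate. -/
theorem mainTheorem2 :
    ∃ (n : ℕ) (R : Set (FreeMonoid (Fin n) × FreeMonoid (Fin n))),
      R.Finite ∧ HomogeneousRels R ∧
        ¬ ComputablePred (OConjugacyProblem R) := by
  obtain ⟨n, R, hR, hword⟩ := exists_finite_not_computablePred_wordProblem
  obtain ⟨m, ⟨e⟩⟩ := Finite.exists_equiv_fin (PaddedAlphabet (Fin n))
  have hreduction : WordProblem R ≤₀ OConjugacyProblem (relabelRels e (paddedRels R)) :=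
    wordProblem_reducible_oConjugacyProblem_paddedRels.trans
      (oConjugacyProblem_reducible_relabelRels e (Primrec.dom_finite e))
  exact ⟨m, relabelRels e (paddedRels R), (finite_paddedRels hR).image _,
    homogeneousRels_paddedRels.relabelRels e,
    fun h => hword (ComputablePred.computable_of_manyOneReducible hreduction h)⟩
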